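/- A Carter subgroup of a group is a nilpotent subgroup that is equal to its own normalizer. Let $G$ be a finite group. A composition factor of $G$ is a quotient $S=A/B$, where $B\trianglelefteq A$ are consecutive terms of a composition series of $G$. For a subgroup $N\le G$, let $\mathrm{Aut}_N(S)\le\mathrm{Aut}(S)$ be the group of automorphisms of $S=A/B$ induced by conjugation by the elements of $N\cap N_G(A)\cap N_G(B)$. If $S$ is non-abelian (so that its centre is trivial), identify $S$ with the group of its inner automorphisms, a subgroup of $\mathrm{Aut}(S)$. Say that $G$ satisfies condition $(*)$ if, for every non-abelian composition factor $S$ of $G$ and for every nilpotent subgroup $N$ of $G$, any two Carter subgroups of $\langle \mathrm{Aut}_N(S), S\rangle$ are conjugate in $\langle \mathrm{Aut}_N(S), S\rangle$ (this holds in particular if there are no Carter subgroups). Lemma. Let $G$ be a finite group satisfying $(*)$, let $H$ be a normal subgroup of $G$, and let $K$ be a Carter subgroup of $G$. Then $KH/H$ is a Carter subgroup of $G/H$. -/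

import Mathlib

namespace CarterSubgroups

/-- A Carter subgroup of a group is a nilpotent subgroup that is equal to its own normalizer. -/
def IsCarter {G : Type*} [Group G] (K : Subgroup G) : Prop :=
  Group.IsNilpotent K ∧ Subgroup.normalizer (K : Set G) = K

/-- The Carter subgroups of `G` (if there are any) are conjugate in `G`: for any two of them `K`
and `L` there is an element `g` with `g K g⁻¹ = L`. -/
def CarterConjugate (G : Type*) [Group G] : Prop :=
  ∀ K L : Subgroup G, IsCarter K → IsCarter L →
    ∃ g : G, K.map (MulAut.conj g).toMonoidHom = L

/-- One step of a composition series: `B` is a normal subgroup of `A` and `A / B` is simple. -/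
def CompositionStep {G : Type*} [Group G] (B A : Subgroup G) : Prop :=
  B ≤ A ∧ ∃ _ : (B.subgroupOf A).Normal, IsSimpleGroup (A ⧸ B.subgroupOf A)

/-- `A / B` is a composition factor of `G`: `B` and `A` are consecutive terms of a composition
series of `G`, that is, of a finite chain of composition steps that starts at the trivial subgroup,
passes from `B` to `A` in one step, and ends at `G`. -/
def IsCompositionFactor {G : Type*} [Group G] (A B : Subgroup G) : Prop :=
  Relation.ReflTransGen CompositionStep ⊥ B ∧ CompositionStep B A ∧
    Relation.ReflTransGen CompositionStep A ⊤

section Induced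

variable {G : Type*} [Group G]

/-- The subgroup `N_G(A / B) = N_G(A) ∩ N_G(B)`. -/
def sectionNormalizer (A B : Subgroup G) : Subgroup G :=
  Subgroup.normalizer (A : Set G) ⊓ Subgroup.normalizer (B : Set G)

/-- The homomorphism from `N_G(A / B)` to `Aut(A)` given by conjugation. -/
def conjHom (A B : Subgroup G) : sectionNormalizer A B →* MulAut A :=
  A.normalizerMonoidHom.comp (Subgroup.inclusion inf_le_left)

theorem conjHom_apply_coe (A B : Subgroup G) (x : sectionNormalizer A B) (a : A) :
    (conjHom A B x a : G) = (x : G) * a * (x : G)⁻¹ := rfl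

theorem conjHom_map (A B : Subgroup G) (x : sectionNormalizer A B) :
    (B.subgroupOf A).map (conjHom A B x) = B.subgroupOf A := by
  have key : ∀ (y : sectionNormalizer A B) (a : A), a ∈ B.subgroupOf A →
      conjHom A B y a ∈ B.subgroupOf A := by
    intro y a ha
    rw [Subgroup.mem_subgroupOf] at ha ⊢
    rw [conjHom_apply_coe]
    exact (Subgroup.mem_normalizer_iff.mp y.2.2 _).mp ha
  apply le_antisymm
  · rintro _ ⟨a, ha, rfl⟩
    exact key x a ha
  · intro a ha
    refine ⟨conjHom A B x⁻¹ a, key x⁻¹ a ha, ?_⟩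
    change (conjHom A B x * conjHom A B x⁻¹) a = a
    rw [← map_mul, mul_inv_cancel, map_one, MulAut.one_apply]

/-- The homomorphism from `N_G(A / B)` to `Aut(A / B)` induced by conjugation. -/
def sectionHom (A B : Subgroup G) [(B.subgroupOf A).Normal] :
    sectionNormalizer A B →* MulAut (A ⧸ B.subgroupOf A) where
  toFun x := QuotientGroup.congr _ _ (conjHom A B x) (conjHom_map A B x)
  map_one' := by
    ext q
    induction q using QuotientGroup.induction_on with
    | H a => simp
  map_mul' x y := by
    ext q
    induction q using QuotientGroup.induction_on with
    | H a => simp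

/-- `Aut_H(A / B)`: the group of automorphisms of `A / B` induced by the elements of
`N_H(A / B) = H ∩ N_G(A) ∩ N_G(B)`. -/
def inducedAut (H A B : Subgroup G) [(B.subgroupOf A).Normal] :
    Subgroup (MulAut (A ⧸ B.subgroupOf A)) :=
  (H.subgroupOf (sectionNormalizer A B)).map (sectionHom A B)

end Induced

/-- Condition `(*)`: for every non-abelian composition factor `S = A / B` of `G` and every nilpotent
subgroup `N` of `G`, the Carter subgroups of `⟨Aut_N(S), S⟩ ≤ Aut(S)` are conjugate, where `S` is
identified with its group of inner automorphisms. -/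
def SatisfiesStar (G : Type*) [Group G] : Prop :=
  ∀ (A B : Subgroup G) [(B.subgroupOf A).Normal], IsCompositionFactor A B →
    (¬ ∀ s t : A ⧸ B.subgroupOf A, s * t = t * s) →
    ∀ N : Subgroup G, Group.IsNilpotent N →
      CarterConjugate
        ↥(inducedAut N A B ⊔ (MulAut.conj : A ⧸ B.subgroupOf A →* MulAut _).range)

end CarterSubgroups

/-! By `isCarter_map_mk` it suffices that `KH` is self-normalizing. Induct on `|G|`, with `M ≤ H`
minimal normal in `G`. If `K` and `K^x` are conjugate in `KM` for every `x` normalizing `KM`, a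
Frattini argument makes `KM` self-normalizing. Then `KM/M` is a Carter subgroup of `G/M`, which
inherits `(*)`, and the conclusion there pulls back to `G`. If `M` is abelian, `KM` is solvable and
Carter's theorem gives the conjugacy.

If `M` is non-abelian, it is the direct product of the conjugates `S` of a simple group `T`, and `G`
permutes these factors. With `P = KM`, the group induced by `P` on `S` is `⟨Aut_K(S), S⟩`, to which
`(*)` applies. The passage from local to global uses `localClosure`: the elements of `KM` that agree
modulo each `C_G(S)` with an element of `K` depending on `S`. This group is solvable, so once a
Carter subgroup `L` is conjugated into it, Carter's theorem conjugates `L` to `K`. The element that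
moves `L` there is glued from local conjugators, one for each orbit of factors
(`exists_conj_mem_localClosure`). They come from `(*)`, because the local images of `K` and `L` are
Carter subgroups (`isCarter_subgroupOf_map`), which is itself proved by gluing. -/

namespace CarterSubgroups

universe u

/-! ### Carter subgroups, conjugation and quotients -/

section Basic

variable {G G' : Type*} [Group G] [Group G']

theorem IsCarter.map_equiv {K : Subgroup G} (hK : IsCarter K) (e : G ≃* G') :
    IsCarter (K.map e.toMonoidHom) := by
  refine ⟨?_, ?_⟩
  · have := hK.1
    exact Group.nilpotent_of_mulEquiv (e.subgroupMap K)
  · have := Subgroup.map_equiv_normalizer_eq K e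
    rw [hK.2] at this
    exact this.symm

theorem map_conj_map (K : Subgroup G) (a b : G) :
    (K.map (MulAut.conj a).toMonoidHom).map (MulAut.conj b).toMonoidHom =
      K.map (MulAut.conj (b * a)).toMonoidHom := by
  rw [Subgroup.map_map]
  congr 1
  ext x
  simp [mul_assoc]

theorem map_conj_one (K : Subgroup G) : K.map (MulAut.conj 1).toMonoidHom = K := by
  ext x
  simp [Subgroup.mem_map]

theorem map_map_conj (f : G →* G') (K : Subgroup G) (a : G) :
    (K.map (MulAut.conj a).toMonoidHom).map f =
      (K.map f).map (MulAut.conj (f a)).toMonoidHom := by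
  rw [Subgroup.map_map, Subgroup.map_map]
  congr 1
  ext x
  simp

theorem mem_normalizer_iff_map_conj {K : Subgroup G} {a : G} :
    a ∈ Subgroup.normalizer (K : Set G) ↔ K.map (MulAut.conj a).toMonoidHom = K :=
  Subgroup.mem_normalizer_iff_map_conj_eq

theorem map_conj_le_iff {K L : Subgroup G} {a : G} :
    K.map (MulAut.conj a).toMonoidHom ≤ L ↔ ∀ k ∈ K, a * k * a⁻¹ ∈ L := by
  rw [Subgroup.map_le_iff_le_comap]
  exact ⟨fun h k hk ↦ by simpa using h hk, fun h k hk ↦ by simpa using h k hk⟩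

theorem IsCarter.conj {K : Subgroup G} (hK : IsCarter K) (a : G) :
    IsCarter (K.map (MulAut.conj a).toMonoidHom) :=
  hK.map_equiv (MulAut.conj a)

theorem CarterConjugate.of_equiv (h : CarterConjugate G) (e : G ≃* G') : CarterConjugate G' := by
  intro K L hK hL
  obtain ⟨g, hg⟩ := h _ _ (hK.map_equiv e.symm) (hL.map_equiv e.symm)
  refine ⟨e g, ?_⟩
  have h2 := congrArg (Subgroup.map e.toMonoidHom) hg
  rw [map_map_conj] at h2
  have h3 : e.toMonoidHom.comp e.symm.toMonoidHom = MonoidHom.id G' := by ext x; simp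
  have h4 : ∀ J : Subgroup G', (J.map e.symm.toMonoidHom).map e.toMonoidHom = J := fun J ↦ by
    rw [Subgroup.map_map, h3, Subgroup.map_id]
  rwa [h4, h4] at h2

theorem IsCarter.subgroupOf {K F : Subgroup G} (hK : IsCarter K) (hKF : K ≤ F) :
    IsCarter (K.subgroupOf F) := by
  refine ⟨?_, ?_⟩
  · have := hK.1
    exact Group.nilpotent_of_mulEquiv (Subgroup.subgroupOfEquivOfLe hKF).symm
  · rw [← Subgroup.subgroupOf_normalizer_eq hKF, hK.2]

theorem CarterConjugate.exists_mem {F K L : Subgroup G} (hF : CarterConjugate F)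
    (hK : IsCarter K) (hL : IsCarter L) (hKF : K ≤ F) (hLF : L ≤ F) :
    ∃ g ∈ F, K.map (MulAut.conj g).toMonoidHom = L := by
  obtain ⟨g, hg⟩ := hF _ _ (hK.subgroupOf hKF) (hL.subgroupOf hLF)
  refine ⟨g, g.2, ?_⟩
  have h2 := congrArg (Subgroup.map F.subtype) hg
  rwa [map_map_conj, Subgroup.subgroupOf_map_subtype, Subgroup.subgroupOf_map_subtype,
    inf_of_le_left hKF, inf_of_le_left hLF] at h2

theorem IsCarter.eq_top [Group.IsNilpotent G] {K : Subgroup G} (hK : IsCarter K) : K = ⊤ :=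
  normalizerCondition_iff_only_full_group_self_normalizing.mp
    Group.normalizerCondition_of_isNilpotent K hK.2

theorem isNilpotent_map {K : Subgroup G} (hK : Group.IsNilpotent K) (f : G →* G') :
    Group.IsNilpotent (K.map f) :=
  Group.nilpotent_of_surjective _ (f.subgroupMap_surjective K)

theorem mem_of_map_conj_eq {K : Subgroup G} (hK : IsCarter K) {a : G}
    (h : K.map (MulAut.conj a).toMonoidHom = K) : a ∈ K := by
  rw [← mem_normalizer_iff_map_conj, hK.2] at h
  exact h

/-- The Frattini argument for Carter subgroups. -/
theorem normalizer_sup_eq {K H : Subgroup G} (hK : IsCarter K)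
    (h : ∀ x ∈ Subgroup.normalizer ((K ⊔ H : Subgroup G) : Set G),
      ∃ y ∈ K ⊔ H, (K.map (MulAut.conj x).toMonoidHom).map (MulAut.conj y).toMonoidHom = K) :
    Subgroup.normalizer ((K ⊔ H : Subgroup G) : Set G) = K ⊔ H := by
  refine le_antisymm (fun x hx ↦ ?_) Subgroup.le_normalizer
  obtain ⟨y, hy, hxy⟩ := h x hx
  rw [map_conj_map] at hxy
  have := (le_sup_left : K ≤ K ⊔ H) (mem_of_map_conj_eq hK hxy)
  simpa using mul_mem (inv_mem hy) this

theorem normalizer_sup_eq_of_carterConjugate {K H : Subgroup G} (hK : IsCarter K)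
    (h : CarterConjugate ↥(K ⊔ H)) :
    Subgroup.normalizer ((K ⊔ H : Subgroup G) : Set G) = K ⊔ H := by
  refine normalizer_sup_eq hK fun x hx ↦ h.exists_mem (hK.conj x) hK ?_ le_sup_left
  calc K.map (MulAut.conj x).toMonoidHom ≤ (K ⊔ H).map (MulAut.conj x).toMonoidHom :=
        Subgroup.map_mono le_sup_left
    _ = K ⊔ H := mem_normalizer_iff_map_conj.mp hx

/-- Normalizers pull back along surjections, and the preimage of the image of `K` is `K ⊔ H`. -/
theorem isCarter_map_mk {K H : Subgroup G} [H.Normal] (hK : Group.IsNilpotent K)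
    (h : Subgroup.normalizer ((K ⊔ H : Subgroup G) : Set G) = K ⊔ H) :
    IsCarter (K.map (QuotientGroup.mk' H)) := by
  refine ⟨isNilpotent_map hK _, ?_⟩
  apply Subgroup.comap_injective (QuotientGroup.mk'_surjective H)
  rw [Subgroup.comap_normalizer_eq_of_surjective _ (QuotientGroup.mk'_surjective H),
    Subgroup.comap_map_eq, QuotientGroup.ker_mk', h]

theorem exists_isMinimalNormal_le [Finite G] {H : Subgroup G} (hH : H.Normal) (h : H ≠ ⊥) :
    ∃ M ≤ H, M.Normal ∧ M ≠ ⊥ ∧ ∀ N : Subgroup G, N.Normal → N ≤ M → N = ⊥ ∨ N = M := by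
  obtain ⟨M, hMH, hM⟩ := exists_minimal_le_of_wellFoundedLT
    (fun M : Subgroup G ↦ M.Normal ∧ M ≠ ⊥) H ⟨hH, h⟩
  refine ⟨M, hMH, hM.prop.1, hM.prop.2, fun N hN hNM ↦ ?_⟩
  by_contra! hcon
  exact hcon.2 (le_antisymm hNM (hM.le_of_le ⟨hN, hcon.1⟩ hNM))

end Basic

/-! ### Carter's theorem for solvable groups -/

section Solvable

variable {G : Type u} [Group G] [Finite G]

theorem sylow_normal_of_quotient_isNilpotent {p : ℕ} [Fact p.Prime] {A : Subgroup G} [A.Normal]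
    [Group.IsNilpotent (G ⧸ A)] (P : Sylow p G) : ((P : Subgroup G) ⊔ A).Normal := by
  have h : (P.mapSurjective (QuotientGroup.mk'_surjective A) : Subgroup (G ⧸ A)).Normal :=
    inferInstance
  have h2 := h.comap (QuotientGroup.mk' A)
  rwa [Sylow.coe_mapSurjective, Subgroup.comap_map_eq, QuotientGroup.ker_mk'] at h2

/-- A Sylow subgroup of the abelian group `A` is characteristic in `A`, hence normal in `G`; by
minimality a nontrivial one is all of `A`. -/
theorem isPGroup_of_minimal_normal {A : Subgroup G} [A.Normal] (hA : A ≠ ⊥)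
    (hmin : ∀ N : Subgroup G, N.Normal → N ≤ A → N = ⊥ ∨ N = A)
    (hcomm : ∀ a ∈ A, ∀ b ∈ A, a * b = b * a) : ∃ p : ℕ, p.Prime ∧ IsPGroup p A := by
  have hcard : Nat.card A ≠ 1 := fun h ↦ hA (Subgroup.card_eq_one.mp h)
  obtain ⟨p, hp, hpA⟩ := Nat.exists_prime_and_dvd hcard
  have : Fact p.Prime := ⟨hp⟩
  refine ⟨p, hp, ?_⟩
  obtain ⟨P⟩ : Nonempty (Sylow p A) := inferInstance
  have hPn : (P : Subgroup A).Normal := ⟨fun n hn g ↦ by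
    have : g * n * g⁻¹ = n := by
      rw [mul_inv_eq_iff_eq_mul]; exact Subtype.ext (hcomm _ g.2 _ n.2)
    rwa [this]⟩
  have := P.characteristic_of_normal hPn
  have hn : ((P : Subgroup A).map A.subtype).Normal := inferInstance
  rcases hmin _ hn (Subgroup.map_subtype_le _) with h | h
  · exfalso
    apply P.ne_bot_of_dvd_card hpA
    exact (Subgroup.map_eq_bot_iff_of_injective _ A.subtype_injective).mp h
  · have h2 : (P : Subgroup A) = ⊤ := by
      apply Subgroup.map_injective A.subtype_injective
      rw [h, ← MonoidHom.range_eq_map, Subgroup.range_subtype]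
    have h3 := P.isPGroup'
    rw [h2] at h3
    exact h3.of_equiv Subgroup.topEquiv

/-- In a finite group with a minimal normal abelian subgroup `A`, a Carter subgroup that covers
the quotient by `A` is the normalizer of a Sylow subgroup. -/
theorem IsCarter.eq_normalizer_sylow {A : Subgroup G} [A.Normal]
    (hmin : ∀ N : Subgroup G, N.Normal → N ≤ A → N = ⊥ ∨ N = A)
    (hcomm : ∀ a ∈ A, ∀ b ∈ A, a * b = b * a) {p q : ℕ} [Fact p.Prime] [Fact q.Prime]
    (hpA : IsPGroup p A) (hpq : q ≠ p) {K : Subgroup G} (hK : IsCarter K) (hKA : K ⊔ A = ⊤)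
    (hq : ∀ Q : Sylow q G, ¬ (Q : Subgroup G).Normal) :
    ∃ Q : Sylow q G, Subgroup.normalizer ((Q : Subgroup G) : Set G) = K := by
  have := hK.1
  obtain ⟨P⟩ : Nonempty (Sylow q K) := inferInstance
  have hPn : (P : Subgroup K).Normal := inferInstance
  have hcardA : (Nat.card A).factorization q = 0 := by
    obtain ⟨n, hn⟩ := IsPGroup.iff_card.mp hpA
    rw [hn, Nat.Prime.factorization_pow Fact.out]
    exact Finsupp.single_eq_of_ne hpq
  -- Since `G = KA` and `q` does not divide `|A|`, a Sylow `q`-subgroup of `K` is already one of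
  -- `G`.
  have hdvd : (Nat.card G).factorization q ≤ (Nat.card K).factorization q := by
    have h1 : Nat.card G ∣ Nat.card K * Nat.card A := by
      rw [Subgroup.card_eq_card_quotient_mul_card_subgroup A]
      refine mul_dvd_mul_right ?_ _
      change A.index ∣ _
      rw [← Subgroup.relIndex_top_right, ← hKA, Subgroup.relIndex_sup_right]
      exact Subgroup.relIndex_dvd_card A K
    have h2 := (Nat.factorization_le_iff_dvd Nat.card_pos.ne'
      (mul_ne_zero Nat.card_pos.ne' Nat.card_pos.ne')).mpr h1 q
    rw [Nat.factorization_mul Nat.card_pos.ne' Nat.card_pos.ne'] at h2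
    simpa [hcardA] using h2
  have hcard : Nat.card ((P : Subgroup K).map K.subtype) = q ^ (Nat.card G).factorization q := by
    rw [Subgroup.card_map_of_injective K.subtype_injective]
    rw [P.card_eq_multiplicity]
    congr 1
    refine le_antisymm ?_ hdvd
    exact (Nat.factorization_le_iff_dvd Nat.card_pos.ne' Nat.card_pos.ne').mpr
      (Subgroup.card_subgroup_dvd_card K) q
  refine ⟨Sylow.ofCard _ hcard, ?_⟩
  have hQn := hq (Sylow.ofCard _ hcard)
  rw [Sylow.coe_ofCard] at hQn ⊢
  set Q := (P : Subgroup K).map K.subtype with hQ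
  set N := Subgroup.normalizer (Q : Set G) with hN
  have hKN : K ≤ N := by
    have := Subgroup.le_normalizer_map (H := (P : Subgroup K)) K.subtype
    rwa [Subgroup.normalizer_eq_top, ← MonoidHom.range_eq_map, Subgroup.range_subtype] at this
  -- `K` normalizes both `N` and `A`, while the abelian group `A` centralizes `N ⊓ A`. So minimality
  -- leaves `N ⊓ A = 1`, giving `N = K`, or `A ≤ N`, giving `N = G`.
  have hNA : (N ⊓ A).Normal := by
    rw [← Subgroup.normalizer_eq_top_iff, ← top_le_iff, ← hKA]
    refine sup_le (Subgroup.le_normalizer_iff.mpr fun k hk n hn ↦ ?_)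
      (Subgroup.le_normalizer_iff.mpr fun a ha n hn ↦ ?_)
    · exact ⟨N.mul_mem (N.mul_mem (hKN hk) hn.1) (N.inv_mem (hKN hk)),
        Subgroup.Normal.conj_mem inferInstance _ hn.2 _⟩
    · rwa [hcomm _ ha _ hn.2, mul_inv_cancel_right]
  have hNe : N = K ⊔ (A ⊓ N) := by
    refine le_antisymm (fun x hx ↦ ?_) (sup_le hKN inf_le_right)
    obtain ⟨k, hk, a, ha, rfl⟩ := Subgroup.mem_sup_of_normal_right.mp
      (hKA ▸ Subgroup.mem_top x : x ∈ K ⊔ A)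
    exact Subgroup.mul_mem_sup hk ⟨ha, (Subgroup.mul_mem_cancel_left N (hKN hk)).mp hx⟩
  rcases hmin _ hNA inf_le_right with h | h
  · rw [hNe, inf_comm, h, sup_bot_eq]
  · exfalso
    apply hQn
    rw [← Subgroup.normalizer_eq_top_iff, ← hN, hNe, inf_comm, h, hKA]

/-- If `G` is not nilpotent, some Sylow `q`-subgroup is not normal, and `q` is not the prime of `A`
because `G/A` is nilpotent. Then `K` and `L` are normalizers of Sylow `q`-subgroups, which are
conjugate. -/
theorem exists_conj_of_sup_eq_top {A : Subgroup G} [A.Normal] (hA : A ≠ ⊥)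
    (hmin : ∀ N : Subgroup G, N.Normal → N ≤ A → N = ⊥ ∨ N = A)
    (hcomm : ∀ a ∈ A, ∀ b ∈ A, a * b = b * a) {K L : Subgroup G} (hK : IsCarter K)
    (hL : IsCarter L) (hKA : K ⊔ A = ⊤) (hLA : L ⊔ A = ⊤) :
    ∃ g : G, K.map (MulAut.conj g).toMonoidHom = L := by
  by_cases hG : Group.IsNilpotent G
  · exact ⟨1, by rw [map_conj_one, hK.eq_top, hL.eq_top]⟩
  have hGA : Group.IsNilpotent (G ⧸ A) := by
    have := isNilpotent_map hK.1 (QuotientGroup.mk' A)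
    have h2 : K.map (QuotientGroup.mk' A) = ⊤ := by
      apply Subgroup.comap_injective (QuotientGroup.mk'_surjective A)
      rw [Subgroup.comap_map_eq, QuotientGroup.ker_mk', hKA, Subgroup.comap_top]
    rw [h2] at this
    exact Group.nilpotent_of_mulEquiv Subgroup.topEquiv
  obtain ⟨p, hp, hpA⟩ := isPGroup_of_minimal_normal hA hmin hcomm
  have : Fact p.Prime := ⟨hp⟩
  have htfae := (Group.isNilpotent_of_finite_tfae (G := G)).out 0 3
  rw [htfae] at hG
  push Not at hG
  obtain ⟨q, hqf, Q, hQ⟩ := hG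
  have hqp : q ≠ p := by
    rintro rfl
    have h1 := sylow_normal_of_quotient_isNilpotent (A := A) Q
    rw [sup_of_le_left (hpA.le_sylow_of_normal Q)] at h1
    exact hQ h1
  have hq : ∀ Q : Sylow q G, ¬ (Q : Subgroup G).Normal := by
    intro R hR
    obtain ⟨g, hg⟩ := MulAction.exists_smul_eq G R Q
    rw [Sylow.smul_eq_of_normal] at hg
    exact hQ (hg ▸ hR)
  obtain ⟨Q₁, h1⟩ := hK.eq_normalizer_sylow hmin hcomm hpA hqp hKA hq
  obtain ⟨Q₂, h2⟩ := hL.eq_normalizer_sylow hmin hcomm hpA hqp hLA hq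
  obtain ⟨g, hg⟩ := MulAction.exists_smul_eq G Q₁ Q₂
  refine ⟨g, ?_⟩
  rw [← h1, ← h2, ← hg, Sylow.coe_subgroup_smul]
  exact Subgroup.map_equiv_normalizer_eq _ (MulAut.conj g)

end Solvable

/-- Carter's theorem: the Carter subgroups of a finite solvable group are conjugate. -/
theorem carterConjugate_of_isSolvable (G : Type u) [Group G] [Finite G] [Group.IsSolvable G] :
    CarterConjugate G := by
  induction hn : Nat.card G using Nat.strong_induction_on generalizing G with
  | _ n ih =>
  intro K L hK hL
  subst hn
  rcases subsingleton_or_nontrivial G with hG | hG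
  · exact ⟨1, Subsingleton.elim _ _⟩
  obtain ⟨A, -, hAn, hA, hmin⟩ :=
    exists_isMinimalNormal_le (H := (⊤ : Subgroup G)) inferInstance top_ne_bot
  have hcomm : ∀ a ∈ A, ∀ b ∈ A, a * b = b * a := by
    have h1 := Group.IsSolvable.commutator_lt_of_ne_bot hA
    have h2 := (hmin ⁅A, A⁆ inferInstance h1.le).resolve_right h1.ne
    intro a ha b hb
    rw [← commutatorElement_eq_one_iff_mul_comm (G := G), ← Subgroup.mem_bot, ← h2]
    exact Subgroup.commutator_mem_commutator ha hb
  have hsub : ∀ F : Subgroup G, F ≠ ⊤ → CarterConjugate F := fun F hF ↦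
    ih _ (lt_of_le_of_ne (Subgroup.card_le_card_group F)
      (fun h ↦ hF (Subgroup.eq_top_of_card_eq F h))) F rfl
  have hquot : ∀ J : Subgroup G, IsCarter J → IsCarter (J.map (QuotientGroup.mk' A)) := by
    intro J hJ
    refine isCarter_map_mk hJ.1 ?_
    by_cases h : J ⊔ A = ⊤
    · rw [h]; exact Subgroup.normalizer_eq_top (H := (⊤ : Subgroup G))
    · exact normalizer_sup_eq_of_carterConjugate hJ (hsub _ h)
  have hlt : Nat.card (G ⧸ A) < Nat.card G := by
    rw [Subgroup.card_eq_card_quotient_mul_card_subgroup A]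
    exact lt_mul_of_one_lt_right Nat.card_pos
      (Subgroup.one_lt_card_iff_ne_bot A |>.mpr hA)
  obtain ⟨g', hg'⟩ := ih _ hlt (G ⧸ A) rfl _ _ (hquot K hK) (hquot L hL)
  obtain ⟨g, rfl⟩ := QuotientGroup.mk'_surjective A g'
  rw [← map_map_conj] at hg'
  -- Conjugacy in `G/A` allows `K` to be replaced by a conjugate with `KA = LA`. If this group is
  -- proper, induction applies inside it.
  have hsup : K.map (MulAut.conj g).toMonoidHom ⊔ A = L ⊔ A := by
    have := congrArg (Subgroup.comap (QuotientGroup.mk' A)) hg'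
    rwa [Subgroup.comap_map_eq, Subgroup.comap_map_eq, QuotientGroup.ker_mk'] at this
  have hK' := hK.conj g
  obtain ⟨y, hy⟩ : ∃ y : G,
      (K.map (MulAut.conj g).toMonoidHom).map (MulAut.conj y).toMonoidHom = L := by
    by_cases h : L ⊔ A = ⊤
    · exact exists_conj_of_sup_eq_top hA hmin hcomm hK' hL (hsup.trans h) h
    · obtain ⟨y, -, hy⟩ := (hsub _ h).exists_mem hK' hL (hsup ▸ le_sup_left) le_sup_left
      exact ⟨y, hy⟩
  exact ⟨y * g, by rw [← hy, map_conj_map]⟩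

/-! ### Gluing local conjugacy along a direct product -/

section Local

variable {G : Type u} [Group G] {ι : Type*} [MulAction G ι]

/-- A normal subgroup `M` that fixes every index, together with subgroups `C i` permuted by
conjugation, such that `M` is the full direct product of its quotients by the `M ∩ C i`. -/
structure IsLocalSystem (M : Subgroup G) (C : ι → Subgroup G) : Prop where
  smul_eq : ∀ i, ∀ c ∈ C i, c • i = i
  conj_mem : ∀ (g : G) (i : ι), ∀ c ∈ C i, g * c * g⁻¹ ∈ C (g • i)
  smul_eq_of_mem : ∀ m ∈ M, ∀ i : ι, m • i = i
  glue : ∀ m : ι → G, (∀ i, m i ∈ M) → ∃ x ∈ M, ∀ i, (m i)⁻¹ * x ∈ C i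
  eq_one : ∀ m ∈ M, (∀ i, m ∈ C i) → m = 1

namespace IsLocalSystem

variable {M : Subgroup G} {C : ι → Subgroup G}

theorem conj_mem' (hS : IsLocalSystem M C) {g c : G} {i j : ι} (hc : c ∈ C i) (h : g • i = j) :
    g * c * g⁻¹ ∈ C j :=
  h ▸ hS.conj_mem g i c hc

theorem smul_eq_smul (hS : IsLocalSystem M C) {g h : G} {i : ι} (hgh : g⁻¹ * h ∈ C i) :
    h • i = g • i := by
  have := hS.smul_eq i _ hgh
  rwa [mul_smul, inv_smul_eq_iff] at this

/-- The elements of `K M` that agree modulo each `C i` with an element of `K`. -/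
def localClosure (hS : IsLocalSystem M C) (K : Subgroup G) : Subgroup G where
  carrier := {g | g ∈ K ⊔ M ∧ ∀ i, ∃ k ∈ K, k⁻¹ * g ∈ C i}
  one_mem' := ⟨one_mem _, fun i ↦ ⟨1, one_mem _, by simp [one_mem]⟩⟩
  mul_mem' := by
    rintro a b ⟨ha, ha'⟩ ⟨hb, hb'⟩
    refine ⟨mul_mem ha hb, fun i ↦ ?_⟩
    obtain ⟨l, hl, hlb⟩ := hb' i
    -- The index is shifted because conjugation by `l⁻¹` carries `C (l • i)` to `C i`.
    obtain ⟨k, hk, hka⟩ := ha' (l • i)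
    refine ⟨k * l, mul_mem hk hl, ?_⟩
    have h1 := hS.conj_mem' (g := l⁻¹) hka (inv_smul_smul l i)
    have h2 := mul_mem h1 hlb
    convert h2 using 1
    group
  inv_mem' := by
    rintro a ⟨ha, ha'⟩
    refine ⟨inv_mem ha, fun i ↦ ?_⟩
    obtain ⟨k, hk, hka⟩ := ha' (a⁻¹ • i)
    refine ⟨k⁻¹, inv_mem hk, ?_⟩
    have h1 := inv_mem (hS.conj_mem' (g := a) hka (smul_inv_smul a i))
    convert h1 using 1
    group

theorem le_localClosure (hS : IsLocalSystem M C) (K : Subgroup G) : K ≤ hS.localClosure K :=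
  fun k hk ↦ ⟨(le_sup_left : K ≤ K ⊔ M) hk, fun i ↦ ⟨k, hk, by simp [one_mem]⟩⟩

theorem localClosure_le (hS : IsLocalSystem M C) (K : Subgroup G) : hS.localClosure K ≤ K ⊔ M :=
  fun _ h ↦ h.1

variable [M.Normal]

/-- Local conjugators at representatives of the orbits can be glued to an element of `M`. -/
theorem exists_conj_mem_localClosure (hS : IsLocalSystem M C) {K L P : Subgroup G}
    (hK : K ⊔ M = P) (hL : L ⊔ M = P) (t : MulAction.orbitRel.Quotient P ι → G)
    (ht : ∀ o, t o ∈ M)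
    (hconj : ∀ o, ∀ l ∈ L, l • o.out = o.out → ∃ k ∈ K, k⁻¹ * (t o * l * (t o)⁻¹) ∈ C o.out) :
    ∃ x ∈ M, (∀ l ∈ L, x * l * x⁻¹ ∈ hS.localClosure K) ∧
      ∀ o, ∃ k ∈ K, ∃ l ∈ L, k • o.out = o.out ∧ l • o.out = o.out ∧
        (k * t o * l)⁻¹ * x ∈ C o.out := by
  let cl : ι → MulAction.orbitRel.Quotient P ι := fun i ↦ Quotient.mk _ i
  have hcl : ∀ g ∈ P, ∀ i, cl (g • i) = cl i := fun g hg i ↦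
    Quotient.sound ⟨⟨g, hg⟩, rfl⟩
  -- `M` fixes all indices, so the orbits of `P = KM` are those of `K`, and likewise those of `L`.
  have hrep : ∀ i, ∃ k ∈ K, k • (cl i).out = i := by
    intro i
    obtain ⟨⟨g, hg⟩, hgi⟩ : (cl i).out ∈ MulAction.orbit P i :=
      Quotient.mk_out (s := MulAction.orbitRel P ι) i
    replace hgi : g • i = (cl i).out := hgi
    have hg' := inv_mem hg
    rw [← hK] at hg'
    obtain ⟨k, hk, m, hm, hkm⟩ := Subgroup.mem_sup_of_normal_right.mp hg'
    refine ⟨k, hk, ?_⟩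
    rw [← hS.smul_eq_of_mem m hm (cl i).out, smul_smul, hkm, ← hgi, inv_smul_smul]
  choose k hk hki using hrep
  have hrepL : ∀ i, ∃ l ∈ L, ∃ m ∈ M, l * m = k i := fun i ↦
    Subgroup.mem_sup_of_normal_right.mp (hL ▸ hK ▸ (le_sup_left : K ≤ K ⊔ M) (hk i))
  choose l hl m hm hlm using hrepL
  have hli : ∀ i, l i • (cl i).out = i := fun i ↦ by
    conv_rhs => rw [← hki i, ← hlm i, mul_smul, hS.smul_eq_of_mem _ (hm i)]
  -- The conjugator prescribed at `i`: go to the representative by `l i`, apply `t` there, return by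
  -- `k i`. It lies in `M` because `k i` and `l i` agree modulo `M`.
  have hμ : ∀ i, k i * t (cl i) * (l i)⁻¹ ∈ M := fun i ↦ by
    have h1 : k i * t (cl i) * (l i)⁻¹ = k i * (t (cl i) * m i) * (k i)⁻¹ := by
      rw [← hlm i]; group
    rw [h1]
    exact Subgroup.Normal.conj_mem inferInstance _ (mul_mem (ht _) (hm i)) _
  obtain ⟨x, hxM, hx⟩ := hS.glue _ hμ
  refine ⟨x, hxM, fun g hg ↦ ⟨?_, fun i ↦ ?_⟩, fun o ↦ ?_⟩
  · have hx' : x ∈ K ⊔ M := (le_sup_right : M ≤ K ⊔ M) hxM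
    refine mul_mem (mul_mem hx' ?_) (inv_mem hx')
    rw [hK, ← hL]
    exact (le_sup_left : L ≤ L ⊔ M) hg
  · have hgP : g ∈ P := hL ▸ (le_sup_left : L ≤ L ⊔ M) hg
    have hj := hcl g hgP i
    have hlj := hli (g • i)
    have hkj := hk (g • i)
    have hxj := hx (g • i)
    rw [hj] at hlj hxj
    -- With `j = g • i`, the element `x * g * x⁻¹` is `k_j * t * (l_j⁻¹ * g * l_i) * t⁻¹ * k_i⁻¹`
    -- modulo `C i`. The bracket lies in `L` and fixes the representative, so `hconj` applies to it.
    obtain ⟨k₀, hk₀, hc⟩ := hconj (cl i) ((l (g • i))⁻¹ * g * l i)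
      (mul_mem (mul_mem (inv_mem (hl _)) hg) (hl _))
      (by rw [mul_smul, mul_smul, hli i, inv_smul_eq_iff, hlj])
    refine ⟨k (g • i) * k₀ * (k i)⁻¹, mul_mem (mul_mem hkj hk₀) (inv_mem (hk i)), ?_⟩
    have h1 := hS.conj_mem' (g := g⁻¹) hxj (inv_smul_smul g i)
    have h2 := mul_mem h1 (inv_mem (hx i))
    have h3 := hS.conj_mem' (g := (l i)⁻¹) h2 (by rw [inv_smul_eq_iff]; exact (hli i).symm)
    have h4 := hS.conj_mem' h3 (hS.smul_eq_of_mem _ (ht (cl i)) _)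
    have h5 := hS.conj_mem' (mul_mem hc h4) (hki i)
    convert h5 using 1
    group
  · have ho : cl o.out = o := Quotient.out_eq o
    have h1 := hki o.out
    have h2 := hli o.out
    have h3 := hx o.out
    rw [ho] at h1 h2 h3
    exact ⟨k o.out, hk _, (l o.out)⁻¹, inv_mem (hl _), h1, by rw [inv_smul_eq_iff, h2], h3⟩

section Finite

variable {N : ι → Subgroup G} {Y : ι → Type*} [∀ i, Group (Y i)]

omit [M.Normal] in
-- `C i` is the kernel of `f i`. The witness `k` need not be assumed in `N i`: it agrees with `g`
-- modulo `C i`, so it fixes `i`.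
theorem map_mem_iff (hS : IsLocalSystem M C) (hN : ∀ i g, g ∈ N i ↔ g • i = i)
    (f : ∀ i, N i →* Y i) (hf : ∀ i (g : N i), f i g = 1 ↔ (g : G) ∈ C i) {K : Subgroup G}
    {i : ι} {g : N i} :
    f i g ∈ (K.subgroupOf (N i)).map (f i) ↔ ∃ k ∈ K, k⁻¹ * (g : G) ∈ C i := by
  constructor
  · rintro ⟨k, hk, hkg⟩
    refine ⟨k, hk, ?_⟩
    rw [← inv_mul_eq_one, ← map_inv, ← map_mul, hf] at hkg
    exact hkg
  · rintro ⟨k, hk, hkg⟩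
    have hki : k • i = i := by rw [← hS.smul_eq_smul hkg, (hN i _).mp g.2]
    refine ⟨⟨k, (hN i k).mpr hki⟩, hk, ?_⟩
    rw [← inv_mul_eq_one, ← map_inv, ← map_mul, hf]
    exact hkg

theorem isNilpotent_map_subgroupOf {K N : Subgroup G} {Y : Type*} [Group Y]
    (hK : Group.IsNilpotent K) (f : N →* Y) : Group.IsNilpotent ((K.subgroupOf N).map f) := by
  refine isNilpotent_map ?_ _
  have h1 : Group.IsNilpotent ↥(N.subgroupOf K) := inferInstance
  rw [← Subgroup.inf_subgroupOf_left] at h1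
  have h2 := Group.nilpotent_of_mulEquiv (Subgroup.subgroupOfEquivOfLe (inf_le_left : K ⊓ N ≤ K))
  rw [← Subgroup.inf_subgroupOf_right]
  exact Group.nilpotent_of_mulEquiv
    (Subgroup.subgroupOfEquivOfLe (inf_le_right : K ⊓ N ≤ N)).symm

/-- The intersection of the closure with `M` embeds in the finite product of the local images of
`K`, which are nilpotent. The quotient by it embeds in the nilpotent group `KM/M`. -/
theorem isSolvable_localClosure [Finite ι] (hS : IsLocalSystem M C) (hN : ∀ i g, g ∈ N i ↔ g • i = i)
    (f : ∀ i, N i →* Y i) (hf : ∀ i (g : N i), f i g = 1 ↔ (g : G) ∈ C i)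
    {K : Subgroup G} (hK : Group.IsNilpotent K) : Group.IsSolvable (hS.localClosure K) := by
  set F := hS.localClosure K with hF
  have hMN : ∀ i, M ≤ N i := fun i m hm ↦ (hN i m).mpr (hS.smul_eq_of_mem m hm i)
  have hmem : ∀ i (x : ↥(F ⊓ M)), f i ⟨x, hMN i x.2.2⟩ ∈ (K.subgroupOf (N i)).map (f i) := by
    intro i x
    exact (hS.map_mem_iff hN f hf).mpr (x.2.1.2 i)
  let Φ : ↥(F ⊓ M) →* ∀ i, ↥((K.subgroupOf (N i)).map (f i)) := MonoidHom.pi fun i ↦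
    ((f i).comp (Subgroup.inclusion (inf_le_right.trans (hMN i)))).codRestrict _ (hmem i)
  have hΦ : Function.Injective Φ := by
    rw [injective_iff_map_eq_one]
    intro x hx
    refine Subtype.ext (hS.eq_one _ x.2.2 fun i ↦ ?_)
    have h1 := congrArg Subtype.val (congrFun hx i)
    exact (hf i _).mp h1
  have hnil : ∀ i, Group.IsNilpotent ↥((K.subgroupOf (N i)).map (f i)) := fun i ↦
    isNilpotent_map_subgroupOf hK (f i)
  have h1 : Group.IsSolvable ↥(F ⊓ M) := Group.isSolvable_of_isSolvable_injective hΦ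
  have hq : ∀ x : F, QuotientGroup.mk' M x ∈ K.map (QuotientGroup.mk' M) := fun x ↦ by
    have hx := (hS.localClosure_le K) x.2
    obtain ⟨k, hk, m, hm, hkm⟩ := Subgroup.mem_sup_of_normal_right.mp hx
    refine ⟨k, hk, ?_⟩
    have h1 : QuotientGroup.mk' M m = 1 := (QuotientGroup.eq_one_iff m).mpr hm
    rw [← hkm, map_mul, h1, mul_one]
  have h2 := isNilpotent_map hK (QuotientGroup.mk' M)
  refine Group.isSolvable_of_ker_le_range (Subgroup.inclusion (inf_le_left : F ⊓ M ≤ F))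
    (((QuotientGroup.mk' M).comp F.subtype).codRestrict _ hq) ?_
  intro x hx
  have h3 : QuotientGroup.mk' M (x : G) = 1 := congrArg Subtype.val hx
  exact ⟨⟨x, x.2, (QuotientGroup.eq_one_iff _).mp h3⟩, rfl⟩

/-- An element `t` of `M` normalizing `K` locally extends to some `x` with `K^x` in the closure of
`K`. Carter's theorem there gives `y` in the closure with `y * x` normalizing `K`, so `y * x ∈ K`
and `x` lies in the closure; read at `o`, this puts `t` locally in `K`. -/
theorem exists_mem_of_conj_mem [Finite G] (hS : IsLocalSystem M C) {K P : Subgroup G} (hK : IsCarter K)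
    (hP : K ⊔ M = P) (hsol : Group.IsSolvable (hS.localClosure K))
    (o : MulAction.orbitRel.Quotient P ι) {t : G} (ht : t ∈ M)
    (h : ∀ k ∈ K, k • o.out = o.out → ∃ k' ∈ K, k'⁻¹ * (t * k * t⁻¹) ∈ C o.out) :
    ∃ k ∈ K, k⁻¹ * t ∈ C o.out := by
  classical
  -- Use `t` on the orbit `o` and the trivial conjugator on every other orbit.
  obtain ⟨x, -, hx, hxo⟩ := hS.exists_conj_mem_localClosure hP hP (Function.update 1 o t)
    (fun o' ↦ by
      by_cases ho : o' = o
      · subst ho; simpa using ht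
      · simp [ho, one_mem])
    (fun o' k hk hko ↦ by
      by_cases ho : o' = o
      · subst ho; simpa using h k hk hko
      · exact ⟨k, hk, by simp [ho, one_mem]⟩)
  obtain ⟨y, hy, hyx⟩ := (carterConjugate_of_isSolvable (hS.localClosure K)).exists_mem
    (hK.conj x) hK (map_conj_le_iff.mpr hx) (hS.le_localClosure K)
  rw [map_conj_map] at hyx
  have hxF : x ∈ hS.localClosure K := by
    have := hS.le_localClosure K (mem_of_map_conj_eq hK hyx)
    simpa using mul_mem (inv_mem hy) this
  obtain ⟨k, hk, hkx⟩ := hxF.2 o.out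
  obtain ⟨k₁, hk₁, l, hl, -, hlo, h1⟩ := hxo o
  rw [Function.update_self] at h1
  refine ⟨(l * k⁻¹ * k₁)⁻¹, inv_mem (mul_mem (mul_mem hl (inv_mem hk)) hk₁), ?_⟩
  have h2 := hS.conj_mem' (mul_mem hkx (inv_mem h1)) hlo
  convert h2 using 1
  group

theorem exists_eq_mul (hS : IsLocalSystem M C) (hN : ∀ i g, g ∈ N i ↔ g • i = i)
    (f : ∀ i, N i →* Y i) {K P : Subgroup G} (hP : K ⊔ M = P) {i : ι} {y : Y i}
    (hy : y ∈ (P.subgroupOf (N i)).map (f i)) :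
    ∃ k t : N i, (k : G) ∈ K ∧ (t : G) ∈ M ∧ y = f i k * f i t := by
  obtain ⟨g, hg, rfl⟩ := hy
  have hg' : (g : G) ∈ K ⊔ M := hP ▸ hg
  obtain ⟨k, hk, t, ht, hkt⟩ := Subgroup.mem_sup_of_normal_right.mp hg'
  have htN : t ∈ N i := (hN i t).mpr (hS.smul_eq_of_mem t ht i)
  have hkN : k ∈ N i := by
    rw [← Subgroup.mul_mem_cancel_right (N i) htN, hkt]
    exact g.2
  exact ⟨⟨k, hkN⟩, ⟨t, htN⟩, hk, ht, by rw [← map_mul]; congr 1; exact Subtype.ext hkt.symm⟩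

/-- An element of the local image of `P = KM` is a product of images from `K` and from `M`. If it
normalizes the image of `K`, so does its `M`-part, which `exists_mem_of_conj_mem` then places in
that image. -/
theorem isCarter_subgroupOf_map [Finite G] [Finite ι] (hS : IsLocalSystem M C)
    (hN : ∀ i g, g ∈ N i ↔ g • i = i)
    (f : ∀ i, N i →* Y i) (hf : ∀ i (g : N i), f i g = 1 ↔ (g : G) ∈ C i)
    {K P : Subgroup G} (hK : IsCarter K) (hP : K ⊔ M = P)
    (o : MulAction.orbitRel.Quotient P ι) :
    IsCarter (((K.subgroupOf (N o.out)).map (f o.out)).subgroupOf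
      ((P.subgroupOf (N o.out)).map (f o.out))) := by
  set i := o.out with hi
  have hKP : K ≤ P := hP ▸ le_sup_left
  have hQD : (K.subgroupOf (N i)).map (f i) ≤ (P.subgroupOf (N i)).map (f i) :=
    Subgroup.map_mono (Subgroup.comap_mono hKP)
  have := isNilpotent_map_subgroupOf hK.1 (f i)
  refine ⟨Group.nilpotent_of_mulEquiv (Subgroup.subgroupOfEquivOfLe hQD).symm, ?_⟩
  rw [← Subgroup.subgroupOf_normalizer_eq hQD]
  ext ⟨y, hy⟩
  rw [Subgroup.mem_subgroupOf, Subgroup.mem_subgroupOf]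
  refine ⟨fun h ↦ ?_, fun h ↦ Subgroup.le_normalizer h⟩
  obtain ⟨k, t, hk, ht, hkt⟩ := hS.exists_eq_mul hN f hP hy
  change y ∈ _ at h
  change y ∈ _
  have hfk : f i k ∈ (K.subgroupOf (N i)).map (f i) := ⟨k, hk, rfl⟩
  rw [hkt] at h ⊢
  refine mul_mem hfk ?_
  rw [hS.map_mem_iff hN f hf]
  replace h := (Subgroup.mul_mem_cancel_left _ (Subgroup.le_normalizer hfk)).mp h
  refine hS.exists_mem_of_conj_mem hK hP (hS.isSolvable_localClosure hN f hf hK.1) o ht ?_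
  intro l hl hlo
  have h1 := (Subgroup.mem_normalizer_iff.mp h (f i ⟨l, (hN i l).mpr hlo⟩)).mp
    ⟨_, hl, rfl⟩
  rw [← map_inv, ← map_mul, ← map_mul] at h1
  exact (hS.map_mem_iff hN f hf).mp h1

theorem exists_conj_eq [Finite G] [Finite ι] (hS : IsLocalSystem M C) (hN : ∀ i g, g ∈ N i ↔ g • i = i)
    (f : ∀ i, N i →* Y i) (hf : ∀ i (g : N i), f i g = 1 ↔ (g : G) ∈ C i)
    {K L P : Subgroup G} (hK : IsCarter K) (hL : IsCarter L) (hKP : K ⊔ M = P) (hLP : L ⊔ M = P)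
    (hconj : ∀ i, CarterConjugate ↥((P.subgroupOf (N i)).map (f i))) :
    ∃ y ∈ P, L.map (MulAut.conj y).toMonoidHom = K := by
  have hloc : ∀ o : MulAction.orbitRel.Quotient P ι, ∃ t ∈ M, ∀ l ∈ L, l • o.out = o.out →
      ∃ k ∈ K, k⁻¹ * (t * l * t⁻¹) ∈ C o.out := by
    intro o
    have hQK := hS.isCarter_subgroupOf_map hN f hf hK hKP o
    have hQL := hS.isCarter_subgroupOf_map hN f hf hL hLP o
    set i := o.out with hi
    obtain ⟨⟨d, hd⟩, hdQ⟩ := hconj i _ _ hQL hQK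
    -- The factor `k` normalizes the local image of `K`, so `t ∈ M` alone is a local conjugator, as
    -- gluing requires.
    obtain ⟨k, t, hk, ht, rfl⟩ := hS.exists_eq_mul hN f hKP hd
    refine ⟨t, ht, fun l hl hli ↦ ?_⟩
    have hfk : f i k ∈ (K.subgroupOf (N i)).map (f i) := ⟨k, hk, rfl⟩
    have hlP : l ∈ P := hLP ▸ (le_sup_left : L ≤ L ⊔ M) hl
    have h1 := map_conj_le_iff.mp hdQ.le
      ⟨f i ⟨l, (hN i l).mpr hli⟩, ⟨_, hlP, rfl⟩⟩ ⟨_, hl, rfl⟩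
    replace h1 : f i k * f i t * f i ⟨l, (hN i l).mpr hli⟩ * (f i k * f i t)⁻¹ ∈
      (K.subgroupOf (N i)).map (f i) := h1
    have h2 := mul_mem (mul_mem (inv_mem hfk) h1) hfk
    have h3 : f i (t * ⟨l, (hN i l).mpr hli⟩ * t⁻¹) ∈ (K.subgroupOf (N i)).map (f i) := by
      convert h2 using 1
      rw [map_mul, map_mul, map_inv]
      group
    exact (hS.map_mem_iff hN f hf).mp h3
  choose t ht htconj using hloc
  obtain ⟨x, hxM, hx, -⟩ := hS.exists_conj_mem_localClosure hKP hLP t ht htconj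
  have := hS.isSolvable_localClosure hN f hf hK.1
  obtain ⟨y, hy, hyx⟩ := (carterConjugate_of_isSolvable (hS.localClosure K)).exists_mem
    (hL.conj x) hK (map_conj_le_iff.mpr hx) (hS.le_localClosure K)
  rw [map_conj_map] at hyx
  exact ⟨y * x, mul_mem (hKP ▸ hS.localClosure_le K hy) (hKP ▸ (le_sup_right : M ≤ K ⊔ M) hxM),
    hyx⟩

end Finite

end IsLocalSystem

end Local

/-! ### Refining normal inclusions to composition series -/

section CompositionSeries

variable {G : Type u} [Group G]

theorem isSimpleGroup_quotient {n : Subgroup G} [n.Normal] (hn : n ≠ ⊤)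
    (h : ∀ m : Subgroup G, m.Normal → n ≤ m → m = n ∨ m = ⊤) : IsSimpleGroup (G ⧸ n) := by
  have : Nontrivial (G ⧸ n) := by
    rw [← not_subsingleton_iff_nontrivial]
    exact fun hs ↦ hn (QuotientGroup.subgroup_eq_top_of_subsingleton n hs)
  refine ⟨fun Q hQ ↦ ?_⟩
  have hle : n ≤ Q.comap (QuotientGroup.mk' n) := by
    conv_lhs => rw [← QuotientGroup.ker_mk' n]
    exact MonoidHom.ker_le_comap _ _
  have hsurj := QuotientGroup.mk'_surjective n
  rcases h _ (hQ.comap (QuotientGroup.mk' n)) hle with h | h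
  · left
    apply Subgroup.comap_injective hsurj
    rw [h, MonoidHom.comap_bot, QuotientGroup.ker_mk']
  · right
    apply Subgroup.comap_injective hsurj
    rw [h, Subgroup.comap_top]

theorem compositionStep_map_subtype {B : Subgroup G} {n : Subgroup B} [n.Normal]
    [IsSimpleGroup (B ⧸ n)] : CompositionStep (n.map B.subtype) B := by
  refine ⟨Subgroup.map_subtype_le n, ?_⟩
  have h : (n.map B.subtype).subgroupOf B = n :=
    Subgroup.comap_map_eq_self_of_injective B.subtype_injective n
  rw [h]
  exact ⟨inferInstance, inferInstance⟩

/-- A maximal proper normal subgroup of `B` containing `A` gives the top step; `A` is still normal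
in it, so the argument repeats. -/
theorem reflTransGen_compositionStep [Finite G] {A B : Subgroup G} (hAB : A ≤ B)
    (hn : B ≤ Subgroup.normalizer (A : Set G)) : Relation.ReflTransGen CompositionStep A B := by
  induction B using WellFoundedLT.induction with
  | _ B ih =>
  by_cases hne : A = B
  · rw [hne]
  have hA : (A.subgroupOf B).Normal := (Subgroup.normal_subgroupOf_iff_le_normalizer hAB).mpr hn
  have hAt : A.subgroupOf B ≠ ⊤ := fun h ↦ hne (le_antisymm hAB (Subgroup.subgroupOf_eq_top.mp h))
  obtain ⟨n, hAn, hmax⟩ := exists_maximal_ge_of_wellFoundedGT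
    (fun n : Subgroup B ↦ n.Normal ∧ n ≠ ⊤) (A.subgroupOf B) ⟨hA, hAt⟩
  have hnn := hmax.prop.1
  have hsimple : IsSimpleGroup (B ⧸ n) := by
    refine isSimpleGroup_quotient hmax.prop.2 fun m hm hnm ↦ ?_
    by_contra! hcon
    exact hcon.1 (le_antisymm (hmax.le_of_ge ⟨hm, hcon.2⟩ hnm) hnm)
  have hle : A ≤ n.map B.subtype := by
    have := Subgroup.map_mono (f := B.subtype) hAn
    rwa [Subgroup.subgroupOf_map_subtype, inf_of_le_left hAB] at this
  have hlt : n.map B.subtype < B := by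
    refine lt_of_le_of_ne (Subgroup.map_subtype_le n) fun h ↦ hmax.prop.2 ?_
    apply Subgroup.map_injective B.subtype_injective
    rw [h, ← MonoidHom.range_eq_map, Subgroup.range_subtype]
  exact (ih _ hlt hle (hlt.le.trans hn)).tail compositionStep_map_subtype

end CompositionSeries

/-! ### Structure of a non-abelian minimal normal subgroup -/

section MinimalNormal

variable {G : Type u} [Group G]

/-- `T` is a minimal normal subgroup of `M`. -/
structure IsMinimalNormalIn (M T : Subgroup G) : Prop where
  le : T ≤ M
  ne_bot : T ≠ ⊥
  le_normalizer : M ≤ Subgroup.normalizer (T : Set G)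
  eq_bot_or_eq : ∀ N ≤ T, M ≤ Subgroup.normalizer (N : Set G) → N = ⊥ ∨ N = T

theorem exists_isMinimalNormalIn [Finite G] {M : Subgroup G} (hM : M ≠ ⊥) :
    ∃ T, IsMinimalNormalIn M T := by
  obtain ⟨T, hTM, hT⟩ := exists_minimal_le_of_wellFoundedLT
    (fun T : Subgroup G ↦ M ≤ Subgroup.normalizer (T : Set G) ∧ T ≠ ⊥) M
    ⟨Subgroup.le_normalizer, hM⟩
  refine ⟨T, hTM, hT.prop.2, hT.prop.1, fun N hNT hN ↦ ?_⟩
  by_contra! hcon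
  exact hcon.2 (le_antisymm hNT (hT.le_of_le ⟨hN, hcon.1⟩ hNT))

theorem le_normalizer_map_conj {M T : Subgroup G} [M.Normal]
    (h : M ≤ Subgroup.normalizer (T : Set G)) (g : G) :
    M ≤ Subgroup.normalizer ((T.map (MulAut.conj g).toMonoidHom : Subgroup G) : Set G) := by
  have h1 : M.map (MulAut.conj g).toMonoidHom = M :=
    mem_normalizer_iff_map_conj.mp (by rw [Subgroup.normalizer_eq_top]; trivial)
  rw [← h1]
  exact (Subgroup.map_mono h).trans (Subgroup.le_normalizer_map _)

theorem IsMinimalNormalIn.conj {M T : Subgroup G} [M.Normal] (hT : IsMinimalNormalIn M T) (g : G) :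
    IsMinimalNormalIn M (T.map (MulAut.conj g).toMonoidHom) where
  le := map_conj_le_iff.mpr fun k hk ↦ Subgroup.Normal.conj_mem inferInstance _ (hT.le hk) _
  ne_bot := fun h ↦ hT.ne_bot
    ((Subgroup.map_eq_bot_iff_of_injective T (MulAut.conj g).injective).mp h)
  le_normalizer := le_normalizer_map_conj hT.le_normalizer g
  eq_bot_or_eq := by
    intro N hN hMN
    have key : (N.map (MulAut.conj g⁻¹).toMonoidHom).map (MulAut.conj g).toMonoidHom = N := by
      rw [map_conj_map, mul_inv_cancel, map_conj_one]
    have h1 : N.map (MulAut.conj g⁻¹).toMonoidHom ≤ T := by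
      have := Subgroup.map_mono (f := (MulAut.conj g⁻¹).toMonoidHom) hN
      rwa [map_conj_map, inv_mul_cancel, map_conj_one] at this
    rcases hT.eq_bot_or_eq _ h1 (le_normalizer_map_conj hMN _) with h | h
    · left; rw [← key, h, Subgroup.map_bot]
    · right; rw [← key, h]

/-- By minimality `S ⊓ T = 1`, and this intersection contains the commutator of `s` and `t`. -/
theorem IsMinimalNormalIn.mul_comm_of_ne {M S T : Subgroup G} (hS : IsMinimalNormalIn M S)
    (hT : IsMinimalNormalIn M T) (hne : S ≠ T) {s t : G} (hs : s ∈ S) (ht : t ∈ T) :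
    s * t = t * s := by
  have hbot : S ⊓ T = ⊥ := by
    have hn : M ≤ Subgroup.normalizer ((S ⊓ T : Subgroup G) : Set G) :=
      Subgroup.le_normalizer_iff.mpr fun m hm x hx ↦
        ⟨(Subgroup.mem_normalizer_iff.mp (hS.le_normalizer hm) x).mp hx.1,
          (Subgroup.mem_normalizer_iff.mp (hT.le_normalizer hm) x).mp hx.2⟩
    refine (hS.eq_bot_or_eq _ inf_le_left hn).resolve_right fun h ↦ ?_
    rcases hT.eq_bot_or_eq _ inf_le_right hn with h' | h'
    · exact hS.ne_bot (h.symm.trans h')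
    · exact hne (h.symm.trans h')
  rw [← commutatorElement_eq_one_iff_mul_comm, ← Subgroup.mem_bot, ← hbot, commutatorElement_def]
  refine ⟨?_, ?_⟩
  · rw [mul_assoc, mul_assoc]
    refine S.mul_mem hs ?_
    rw [← mul_assoc]
    exact (Subgroup.mem_normalizer_iff.mp (hS.le_normalizer (hT.le ht)) _).mp (S.inv_mem hs)
  · refine T.mul_mem ?_ (T.inv_mem ht)
    exact (Subgroup.mem_normalizer_iff.mp (hT.le_normalizer (hS.le hs)) _).mp ht

/-- The type of conjugates of a subgroup. -/
def Conjugates (T : Subgroup G) : Type u :=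
  {S : Subgroup G // ∃ g : G, T.map (MulAut.conj g).toMonoidHom = S}

instance (T : Subgroup G) [Finite G] : Finite (Conjugates T) :=
  inferInstanceAs (Finite {S : Subgroup G // ∃ g : G, T.map (MulAut.conj g).toMonoidHom = S})

instance (T : Subgroup G) : MulAction G (Conjugates T) where
  smul g S := ⟨S.1.map (MulAut.conj g).toMonoidHom, by
    obtain ⟨a, ha⟩ := S.2
    exact ⟨g * a, by rw [← ha, map_conj_map]⟩⟩
  one_smul S := Subtype.ext (map_conj_one S.1)
  mul_smul a b S := Subtype.ext (map_conj_map S.1 b a).symm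

theorem Conjugates.smul_val {T : Subgroup G} (g : G) (S : Conjugates T) :
    (g • S).1 = S.1.map (MulAut.conj g).toMonoidHom := rfl

theorem Conjugates.smul_eq_iff {T : Subgroup G} {g : G} {S : Conjugates T} :
    g • S = S ↔ g ∈ Subgroup.normalizer (S.1 : Set G) := by
  rw [mem_normalizer_iff_map_conj, ← Conjugates.smul_val]
  exact Subtype.ext_iff

/-- A non-abelian minimal normal subgroup `M` with a minimal normal subgroup `T` of `M`. -/
structure IsNonabelianMinimal (M T : Subgroup G) : Prop where
  normal : M.Normal
  eq_bot_or_eq : ∀ N : Subgroup G, N.Normal → N ≤ M → N = ⊥ ∨ N = M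
  noncomm : ¬ ∀ a ∈ M, ∀ b ∈ M, a * b = b * a
  isMinimalNormalIn : IsMinimalNormalIn M T

namespace IsNonabelianMinimal

variable {M T : Subgroup G}

theorem conj (h : IsNonabelianMinimal M T) (S : Conjugates T) : IsMinimalNormalIn M S.1 := by
  obtain ⟨S, g, rfl⟩ := S
  have := h.normal
  exact h.isMinimalNormalIn.conj g

/-- The join of all conjugates is normal in `G`, nontrivial and inside `M`. -/
theorem iSup_conjugates (h : IsNonabelianMinimal M T) : ⨆ S : Conjugates T, S.1 = M := by
  let S₀ : Conjugates T := ⟨T, 1, map_conj_one T⟩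
  have hn : (⨆ S : Conjugates T, S.1).Normal := by
    rw [← Subgroup.normalizer_eq_top_iff, eq_top_iff]
    intro g _
    rw [mem_normalizer_iff_map_conj, Subgroup.map_iSup]
    exact (MulAction.toPerm g : Equiv.Perm (Conjugates T)).iSup_congr fun S ↦ rfl
  refine (h.eq_bot_or_eq _ hn (iSup_le fun S ↦ (h.conj S).le)).resolve_left fun hb ↦ ?_
  exact (h.conj S₀).ne_bot (le_bot_iff.mp (hb ▸ le_iSup (fun S : Conjugates T ↦ S.1) S₀))

theorem le_centralizer_of_ne (h : IsNonabelianMinimal M T) {R S : Conjugates T} (hne : R ≠ S) :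
    R.1 ≤ Subgroup.centralizer (S.1 : Set G) := by
  intro r hr
  rw [Subgroup.mem_centralizer_iff]
  intro s hs
  exact (h.conj S).mul_comm_of_ne (h.conj R) (fun e ↦ hne (Subtype.ext e.symm)) hs hr

/-- `M` is generated by `S` and by conjugates that centralize `S`. The element `s` is the
`S`-component of `m`, up to the centre of `S`. -/
theorem exists_mem_mem_centralizer (h : IsNonabelianMinimal M T) (S : Conjugates T) {m : G}
    (hm : m ∈ M) : ∃ s ∈ S.1, s⁻¹ * m ∈ Subgroup.centralizer (S.1 : Set G) := by
  rw [← h.iSup_conjugates] at hm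
  induction hm using Subgroup.iSup_induction' with
  | hp R x hx =>
    by_cases hRS : R = S
    · subst hRS
      exact ⟨x, hx, by simp [one_mem]⟩
    · exact ⟨1, one_mem _, by simpa using h.le_centralizer_of_ne hRS hx⟩
  | h1 => exact ⟨1, one_mem _, by simp [one_mem]⟩
  | hmul x y _ _ hx hy =>
    obtain ⟨s, hs, hsx⟩ := hx
    obtain ⟨t, ht, hty⟩ := hy
    refine ⟨s * t, mul_mem hs ht, ?_⟩
    have h1 := mul_mem hsx hty
    have h2 := Subgroup.mem_centralizer_iff.mp hsx t ht
    convert h1 using 1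
    calc (s * t)⁻¹ * (x * y) = t⁻¹ * (s⁻¹ * x * t) * (t⁻¹ * y) := by group
      _ = t⁻¹ * (t * (s⁻¹ * x)) * (t⁻¹ * y) := by rw [h2]
      _ = _ := by group

/-- Such an `m` is central in `M`. The centre of `M` is normal in `G` and proper in the non-abelian
group `M`, hence trivial. -/
theorem eq_one_of_mem_centralizer (h : IsNonabelianMinimal M T) {m : G} (hm : m ∈ M)
    (hc : ∀ S : Conjugates T, m ∈ Subgroup.centralizer (S.1 : Set G)) : m = 1 := by
  have := h.normal
  have hmc : m ∈ Subgroup.centralizer (M : Set G) := by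
    have h1 : M ≤ Subgroup.centralizer {m} := by
      conv_lhs => rw [← h.iSup_conjugates]
      refine iSup_le fun S s hs ↦ ?_
      rw [Subgroup.mem_centralizer_singleton_iff]
      exact (Subgroup.mem_centralizer_iff.mp (hc S) s hs)
    rw [Subgroup.mem_centralizer_iff]
    exact fun x hx ↦ (Subgroup.mem_centralizer_singleton_iff.mp (h1 hx))
  have hn : (M ⊓ Subgroup.centralizer (M : Set G)).Normal := inferInstance
  rcases h.eq_bot_or_eq _ hn inf_le_left with hb | hb
  · rw [← Subgroup.mem_bot, ← hb]
    exact ⟨hm, hmc⟩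
  · exfalso
    refine h.noncomm fun a ha b hb' ↦ ?_
    rw [← hb] at hb'
    exact Subgroup.mem_centralizer_iff.mp hb'.2 a ha

theorem isLocalSystem [Finite G] (h : IsNonabelianMinimal M T) :
    IsLocalSystem M (fun S : Conjugates T ↦ Subgroup.centralizer (S.1 : Set G)) where
  smul_eq S c hc := Conjugates.smul_eq_iff.mpr (Subgroup.centralizer_le_normalizer _ hc)
  conj_mem g S c hc := by
    rw [Subgroup.mem_centralizer_iff]
    rintro _ ⟨s, hs, rfl⟩
    have := Subgroup.mem_centralizer_iff.mp hc s hs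
    change g * s * g⁻¹ * (g * c * g⁻¹) = g * c * g⁻¹ * (g * s * g⁻¹)
    calc g * s * g⁻¹ * (g * c * g⁻¹) = g * (s * c) * g⁻¹ := by group
      _ = g * (c * s) * g⁻¹ := by rw [this]
      _ = _ := by group
  smul_eq_of_mem m hm S := Conjugates.smul_eq_iff.mpr ((h.conj S).le_normalizer hm)
  eq_one m hm hc := h.eq_one_of_mem_centralizer hm hc
  glue m hm := by
    classical
    have := Fintype.ofFinite (Conjugates T)
    choose t ht htm using fun S ↦ h.exists_mem_mem_centralizer S (hm S)
    -- The glued element is the product of the components `t S`, built one factor at a time; a new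
    -- factor `t R` is invisible modulo the centralizers of the other conjugates.
    have key : ∀ s : Finset (Conjugates T), ∃ x ∈ M,
        (∀ S ∈ s, (t S)⁻¹ * x ∈ Subgroup.centralizer (S.1 : Set G)) ∧
        ∀ S ∉ s, x ∈ Subgroup.centralizer (S.1 : Set G) := by
      intro s
      induction s using Finset.induction_on with
      | empty => exact ⟨1, one_mem _, by simp, fun S _ ↦ one_mem _⟩
      | insert R s hR ih =>
        obtain ⟨x, hx, h1, h2⟩ := ih
        refine ⟨x * t R, mul_mem hx ((h.conj R).le (ht R)), fun S hS ↦ ?_, fun S hS ↦ ?_⟩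
        · rcases Finset.mem_insert.mp hS with rfl | hSs
          · have h3 := Subgroup.mem_centralizer_iff.mp (h2 S hR) _ (ht S)
            rw [← h3, inv_mul_cancel_left]
            exact h2 S hR
          · rw [← mul_assoc]
            refine mul_mem (h1 S hSs) (h.le_centralizer_of_ne ?_ (ht R))
            rintro rfl
            exact hR hSs
        · rw [Finset.mem_insert, not_or] at hS
          exact mul_mem (h2 S hS.2) (h.le_centralizer_of_ne (Ne.symm hS.1) (ht R))
    obtain ⟨x, hx, h1, -⟩ := key Finset.univ
    refine ⟨x, hx, fun S ↦ ?_⟩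
    have := mul_mem (inv_mem (htm S)) (h1 S (Finset.mem_univ S))
    simpa using this

theorem noncomm_conjugate (h : IsNonabelianMinimal M T) (S : Conjugates T) :
    ¬ ∀ a ∈ S.1, ∀ b ∈ S.1, a * b = b * a := by
  intro hcomm
  refine (h.conj S).ne_bot ((Subgroup.eq_bot_iff_forall _).mpr fun s hs ↦ ?_)
  refine h.eq_one_of_mem_centralizer ((h.conj S).le hs) fun R ↦ ?_
  by_cases hRS : S = R
  · subst hRS
    exact Subgroup.mem_centralizer_iff.mpr fun r hr ↦ hcomm r hr s hs
  · exact h.le_centralizer_of_ne hRS hs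

/-- A normal subgroup of `S` is normalized by `M`, since each element of `M` acts on `S` as an
element of `S`; so minimality in `M` makes `S` simple. The normal inclusions of `S` in `M` and of
`M` in `G` refine to a composition series. -/
theorem isCompositionFactor [Finite G] (h : IsNonabelianMinimal M T) (S : Conjugates T) :
    IsCompositionFactor S.1 ⊥ := by
  have := h.normal
  have hS := h.conj S
  refine ⟨.refl, ?_, (reflTransGen_compositionStep hS.le hS.le_normalizer).trans
    (reflTransGen_compositionStep le_top (by rw [Subgroup.normalizer_eq_top]))⟩
  have hsimple : IsSimpleGroup (S.1 ⧸ (⊥ : Subgroup S.1)) := by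
    refine isSimpleGroup_quotient (fun e ↦ hS.ne_bot ?_) fun m hm _ ↦ ?_
    · have h1 := congrArg (Subgroup.map S.1.subtype) e
      rw [Subgroup.map_bot, ← MonoidHom.range_eq_map, Subgroup.range_subtype] at h1
      exact h1.symm
    · have hmn : M ≤ Subgroup.normalizer ((m.map S.1.subtype : Subgroup G) : Set G) := by
        rw [Subgroup.le_normalizer_iff]
        rintro x hx _ ⟨a, ha, rfl⟩
        obtain ⟨s, hs, hsx⟩ := h.exists_mem_mem_centralizer S hx
        have h1 := Subgroup.mem_centralizer_iff.mp hsx a a.2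
        refine ⟨⟨s, hs⟩ * a * ⟨s, hs⟩⁻¹, hm.conj_mem a ha _, ?_⟩
        have h2 : x = s * (s⁻¹ * x) := by group
        change s * a * s⁻¹ = x * a * x⁻¹
        rw [h2, mul_assoc s (s⁻¹ * x), ← h1]
        group
      rcases hS.eq_bot_or_eq _ (Subgroup.map_subtype_le m) hmn with h1 | h1
      · left
        exact (Subgroup.map_eq_bot_iff_of_injective _ S.1.subtype_injective).mp h1
      · right
        apply Subgroup.map_injective S.1.subtype_injective
        rw [h1, ← MonoidHom.range_eq_map, Subgroup.range_subtype]
  have h1 := compositionStep_map_subtype (n := (⊥ : Subgroup S.1))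
  rwa [Subgroup.map_bot] at h1

end IsNonabelianMinimal

end MinimalNormal

/-! ### Applying `(*)` to the simple factors -/

section InducedAutomorphisms

variable {G : Type u} [Group G]

theorem sectionHom_mk (A B : Subgroup G) [(B.subgroupOf A).Normal] (x : sectionNormalizer A B)
    (a : A) : sectionHom A B x (QuotientGroup.mk a) = QuotientGroup.mk (conjHom A B x a) := rfl

theorem sectionHom_eq_one_iff {S : Subgroup G} {x : sectionNormalizer S ⊥} :
    sectionHom S ⊥ x = 1 ↔ (x : G) ∈ Subgroup.centralizer (S : Set G) := by
  have key : ∀ a : S, sectionHom S ⊥ x (QuotientGroup.mk a) = QuotientGroup.mk a ↔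
      (a : G) * x = x * a := by
    intro a
    rw [sectionHom_mk, QuotientGroup.eq, Subgroup.mem_subgroupOf, Subgroup.mem_bot, Subgroup.coe_mul,
      Subgroup.coe_inv, conjHom_apply_coe, inv_mul_eq_one, mul_inv_eq_iff_eq_mul, eq_comm]
  rw [Subgroup.mem_centralizer_iff]
  constructor
  · intro h a ha
    exact (key ⟨a, ha⟩).mp (by rw [h]; rfl)
  · intro h
    ext q
    induction q using QuotientGroup.induction_on with
    | H a => exact (key a).mpr (h a a.2)

theorem mem_sectionNormalizer_bot {S : Subgroup G} {g : G} :
    g ∈ sectionNormalizer S ⊥ ↔ g ∈ Subgroup.normalizer (S : Set G) := by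
  refine ⟨fun h ↦ h.1, fun h ↦ ⟨h, ?_⟩⟩
  rw [Subgroup.normalizer_eq_top]
  trivial

/-- Each element of `M` normalizes `S` and acts on it as the inner automorphism given by its
`S`-component. This brings the local image of `KM` into the form required by `(*)`. -/
theorem IsNonabelianMinimal.inducedAut_sup {M T : Subgroup G} (h : IsNonabelianMinimal M T)
    (S : Conjugates T) (K : Subgroup G) :
    inducedAut (K ⊔ M) S.1 ⊥ =
      inducedAut K S.1 ⊥ ⊔ (MulAut.conj : S.1 ⧸ (⊥ : Subgroup G).subgroupOf S.1 →* MulAut _).range := by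
  have := h.normal
  have hinn : ∀ s : S.1, ∃ hs : (s : G) ∈ sectionNormalizer S.1 ⊥,
      sectionHom S.1 ⊥ ⟨s, hs⟩ = MulAut.conj (QuotientGroup.mk s) := by
    intro s
    refine ⟨mem_sectionNormalizer_bot.mpr (Subgroup.le_normalizer s.2), ?_⟩
    ext q
    induction q using QuotientGroup.induction_on with
    | H a => rfl
  apply le_antisymm
  · rintro _ ⟨g, hg, rfl⟩
    obtain ⟨k, hk, m, hm, hkm⟩ := Subgroup.mem_sup_of_normal_right.mp
      (show (g : G) ∈ K ⊔ M from hg)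
    have hmN : m ∈ sectionNormalizer S.1 ⊥ :=
      mem_sectionNormalizer_bot.mpr ((h.conj S).le_normalizer hm)
    have hkN : k ∈ sectionNormalizer S.1 ⊥ := by
      rw [← Subgroup.mul_mem_cancel_right _ hmN, hkm]
      exact g.2
    obtain ⟨s, hs, hsm⟩ := h.exists_mem_mem_centralizer S hm
    obtain ⟨hsN, hse⟩ := hinn ⟨s, hs⟩
    have h1 : g = ⟨k, hkN⟩ * ⟨m, hmN⟩ := Subtype.ext hkm.symm
    have h2 : sectionHom S.1 ⊥ ⟨m, hmN⟩ = sectionHom S.1 ⊥ ⟨s, hsN⟩ := by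
      rw [eq_comm, ← inv_mul_eq_one, ← map_inv, ← map_mul, sectionHom_eq_one_iff]
      exact hsm
    rw [h1, map_mul, h2]
    exact Subgroup.mul_mem_sup ⟨_, hk, rfl⟩ ⟨_, hse.symm⟩
  · refine sup_le (Subgroup.map_mono (Subgroup.comap_mono le_sup_left)) ?_
    rintro _ ⟨q, rfl⟩
    induction q using QuotientGroup.induction_on with
    | H s =>
      obtain ⟨hsN, hse⟩ := hinn s
      exact ⟨_, (le_sup_right : M ≤ K ⊔ M) ((h.conj S).le s.2), hse⟩

theorem IsNonabelianMinimal.noncomm_quotient_bot {M T : Subgroup G} (h : IsNonabelianMinimal M T)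
    (S : Conjugates T) : ¬ ∀ s t : S.1 ⧸ (⊥ : Subgroup G).subgroupOf S.1, s * t = t * s := by
  intro hcomm
  refine h.noncomm_conjugate S fun a ha b hb ↦ ?_
  have h1 := hcomm (QuotientGroup.mk ⟨a, ha⟩) (QuotientGroup.mk ⟨b, hb⟩)
  rw [← QuotientGroup.mk_mul, ← QuotientGroup.mk_mul, QuotientGroup.eq, Subgroup.mem_subgroupOf,
    Subgroup.mem_bot, Subgroup.coe_mul, Subgroup.coe_inv, inv_mul_eq_one] at h1
  exact h1

theorem IsNonabelianMinimal.exists_conj_eq [Finite G] (hG : SatisfiesStar G) {M T : Subgroup G}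
    (h : IsNonabelianMinimal M T) {K L P : Subgroup G} (hK : IsCarter K) (hL : IsCarter L)
    (hKP : K ⊔ M = P) (hLP : L ⊔ M = P) :
    ∃ y ∈ P, L.map (MulAut.conj y).toMonoidHom = K := by
  have := h.normal
  have hN : ∀ (S : Conjugates T) (g : G), g ∈ sectionNormalizer S.1 ⊥ ↔ g • S = S :=
    fun S g ↦ mem_sectionNormalizer_bot.trans Conjugates.smul_eq_iff.symm
  have hconj : ∀ S : Conjugates T, CarterConjugate ↥(inducedAut P S.1 ⊥) := by
    intro S
    rw [← hKP, h.inducedAut_sup S K]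
    exact hG S.1 ⊥ (h.isCompositionFactor S) (h.noncomm_quotient_bot S) K hK.1
  exact h.isLocalSystem.exists_conj_eq hN (fun S ↦ sectionHom S.1 ⊥)
    (fun S g ↦ sectionHom_eq_one_iff) hK hL hKP hLP hconj

end InducedAutomorphisms

/-! ### Lifting nilpotent subgroups from a quotient -/

section NilpotentSupplement

variable {G : Type u} [Group G] [Finite G]

/-- A nilpotent subgroup of a quotient of a finite group is the image of a nilpotent subgroup. -/
theorem exists_isNilpotent_map_mk_eq {M : Subgroup G} [M.Normal] {J : Subgroup (G ⧸ M)}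
    (hJ : Group.IsNilpotent J) :
    ∃ N : Subgroup G, Group.IsNilpotent N ∧ N.map (QuotientGroup.mk' M) = J := by
  have hsurj := QuotientGroup.mk'_surjective M
  obtain ⟨N, -, hN⟩ := exists_minimal_le_of_wellFoundedLT
    (fun N : Subgroup G ↦ N.map (QuotientGroup.mk' M) = J) (J.comap (QuotientGroup.mk' M))
    (Subgroup.map_comap_eq_self_of_surjective hsurj J)
  refine ⟨N, ?_, hN.prop⟩
  let π : N →* J := ((QuotientGroup.mk' M).comp N.subtype).codRestrict J
    (fun x ↦ hN.prop ▸ ⟨x, x.2, rfl⟩)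
  have hπ : Function.Surjective π := by
    rintro ⟨y, hy⟩
    rw [← hN.prop] at hy
    obtain ⟨x, hx, rfl⟩ := hy
    exact ⟨⟨x, hx⟩, rfl⟩
  have hker : Group.IsNilpotent (N ⧸ π.ker) :=
    Group.nilpotent_of_mulEquiv (QuotientGroup.quotientKerEquivOfSurjective π hπ).symm
  have htfae := (Group.isNilpotent_of_finite_tfae (G := N)).out 0 3
  rw [htfae]
  intro q hq Q
  have hn := sylow_normal_of_quotient_isNilpotent (A := π.ker) Q
  -- The Frattini argument for the normal subgroup `Q ⊔ π.ker` shows that the normalizer of `Q` in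
  -- `N` still maps onto `J`. As `N` is minimal with this property, `Q` is normal in `N`.
  have h1 := Sylow.normalizer_sup_eq_top' Q (le_sup_left : (Q : Subgroup N) ≤ (Q : Subgroup N) ⊔ π.ker)
  have hle : (Q : Subgroup N) ≤ Subgroup.normalizer ((Q : Subgroup N) : Set N) :=
    Subgroup.le_normalizer
  replace h1 : Subgroup.normalizer ((Q : Subgroup N) : Set N) ⊔ ((Q : Subgroup N) ⊔ π.ker) = ⊤ := h1
  rw [← sup_assoc, sup_of_le_left hle] at h1
  rw [← Subgroup.normalizer_eq_top_iff]
  set R := Subgroup.normalizer ((Q : Subgroup N) : Set N) with hR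
  have h2 : (R.map N.subtype).map (QuotientGroup.mk' M) = J := by
    refine le_antisymm ?_ ?_
    · rw [← hN.prop]
      exact Subgroup.map_mono (Subgroup.map_subtype_le R)
    · intro y hy
      obtain ⟨x, hx⟩ := hπ ⟨y, hy⟩
      obtain ⟨r, hr, c, hc, rfl⟩ := Subgroup.mem_sup_of_normal_right.mp
        (h1 ▸ Subgroup.mem_top x : x ∈ R ⊔ π.ker)
      refine ⟨r, ⟨r, hr, rfl⟩, ?_⟩
      rw [map_mul, (MonoidHom.mem_ker).mp hc, mul_one] at hx
      exact congrArg Subtype.val hx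
  have h3 := hN.le_of_le h2 (Subgroup.map_subtype_le R)
  rw [eq_top_iff]
  intro x _
  obtain ⟨r, hr, hrx⟩ := h3 x.2
  have : r = x := Subtype.ext hrx
  exact this ▸ hr

end NilpotentSupplement

/-! ### Condition `(*)` passes to quotients -/

section Quotient

variable {G Q : Type*} [Group G] [Group Q] {f : G →* Q}

theorem normal_subgroupOf_comap (f : G →* Q) {A B : Subgroup Q} (h : (B.subgroupOf A).Normal) :
    ((B.comap f).subgroupOf (A.comap f)).Normal :=
  h.comap (f.subgroupComap A)

/-- A section of the image of a surjective homomorphism is isomorphic to its preimage. -/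
noncomputable def sectionEquiv (hf : Function.Surjective f) (A B : Subgroup Q)
    [(B.subgroupOf A).Normal] [((B.comap f).subgroupOf (A.comap f)).Normal] :
    A.comap f ⧸ (B.comap f).subgroupOf (A.comap f) ≃* A ⧸ B.subgroupOf A :=
  QuotientGroup.liftEquiv _
    (φ := (QuotientGroup.mk' (B.subgroupOf A)).comp (f.subgroupComap A))
    ((QuotientGroup.mk'_surjective _).comp (f.subgroupComap_surjective_of_surjective A hf))
    (by rw [← MonoidHom.comap_ker, QuotientGroup.ker_mk']; rfl)

theorem sectionEquiv_mk (hf : Function.Surjective f) (A B : Subgroup Q)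
    [(B.subgroupOf A).Normal] [((B.comap f).subgroupOf (A.comap f)).Normal] (a : A.comap f) :
    sectionEquiv hf A B (QuotientGroup.mk a) = QuotientGroup.mk ⟨f a, a.2⟩ := rfl

theorem CompositionStep.comap (hf : Function.Surjective f) {A B : Subgroup Q}
    (h : CompositionStep B A) : CompositionStep (B.comap f) (A.comap f) := by
  obtain ⟨hle, hn, hs⟩ := h
  have := normal_subgroupOf_comap f hn
  exact ⟨Subgroup.comap_mono hle, this, (sectionEquiv hf A B).isSimpleGroup⟩

/-- The series pulled back from `G/M` starts at `M`; it is completed below by composition steps from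
`1` to `M`. -/
theorem IsCompositionFactor.comap_mk {M : Subgroup G} [M.Normal] [Finite G]
    {A B : Subgroup (G ⧸ M)} (h : IsCompositionFactor A B) :
    IsCompositionFactor (A.comap (QuotientGroup.mk' M)) (B.comap (QuotientGroup.mk' M)) := by
  have hsurj := QuotientGroup.mk'_surjective M
  obtain ⟨h1, h2, h3⟩ := h
  have hlift : ∀ {C D : Subgroup (G ⧸ M)}, Relation.ReflTransGen CompositionStep C D →
      Relation.ReflTransGen CompositionStep (C.comap (QuotientGroup.mk' M))
        (D.comap (QuotientGroup.mk' M)) :=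
    fun h ↦ h.lift (Subgroup.comap (QuotientGroup.mk' M)) fun _ _ h ↦ h.comap hsurj
  have h1' := hlift h1
  have h3' := hlift h3
  rw [MonoidHom.comap_bot, QuotientGroup.ker_mk'] at h1'
  rw [Subgroup.comap_top] at h3'
  refine ⟨(reflTransGen_compositionStep bot_le ?_).trans h1', h2.comap hsurj, h3'⟩
  rw [Subgroup.normalizer_eq_top]
  exact le_top

theorem sectionNormalizer_comap (hf : Function.Surjective f) (A B : Subgroup Q) :
    sectionNormalizer (A.comap f) (B.comap f) = (sectionNormalizer A B).comap f := by
  rw [sectionNormalizer, sectionNormalizer, Subgroup.comap_inf,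
    Subgroup.comap_normalizer_eq_of_surjective _ hf, Subgroup.comap_normalizer_eq_of_surjective _ hf]

theorem congr_sectionHom (hf : Function.Surjective f) (A B : Subgroup Q)
    [(B.subgroupOf A).Normal] [((B.comap f).subgroupOf (A.comap f)).Normal]
    (x : sectionNormalizer (A.comap f) (B.comap f)) (hx : f x ∈ sectionNormalizer A B) :
    MulAut.congr (sectionEquiv hf A B) (sectionHom (A.comap f) (B.comap f) x) =
      sectionHom A B ⟨f x, hx⟩ := by
  ext q
  obtain ⟨q, rfl⟩ := (sectionEquiv hf A B).surjective q
  induction q using QuotientGroup.induction_on with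
  | H a =>
    change sectionEquiv hf A B (sectionHom _ _ x ((sectionEquiv hf A B).symm _)) = _
    rw [MulEquiv.symm_apply_apply, sectionHom_mk, sectionEquiv_mk, sectionEquiv_mk, sectionHom_mk]
    congr 1
    apply Subtype.ext
    change f (x * a * (x : G)⁻¹) = f x * f a * (f x)⁻¹
    simp

theorem map_congr_inducedAut (hf : Function.Surjective f) (A B : Subgroup Q) (N : Subgroup G)
    [(B.subgroupOf A).Normal] [((B.comap f).subgroupOf (A.comap f)).Normal] :
    (inducedAut N (A.comap f) (B.comap f)).map
      (MulAut.congr (sectionEquiv hf A B)).toMonoidHom = inducedAut (N.map f) A B := by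
  have hsn : ∀ x : G, x ∈ sectionNormalizer (A.comap f) (B.comap f) ↔
      f x ∈ sectionNormalizer A B := fun x ↦ by rw [sectionNormalizer_comap hf A B]; rfl
  ext α
  constructor
  · rintro ⟨_, ⟨x, hx, rfl⟩, rfl⟩
    have hx' : f x ∈ sectionNormalizer A B := (hsn x).mp x.2
    exact ⟨⟨f x, hx'⟩, ⟨x, hx, rfl⟩, (congr_sectionHom hf A B x hx').symm⟩
  · rintro ⟨⟨_, hy⟩, ⟨x, hx, rfl⟩, rfl⟩
    have hx' : x ∈ sectionNormalizer (A.comap f) (B.comap f) := (hsn x).mpr hy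
    exact ⟨_, ⟨⟨x, hx'⟩, hx, rfl⟩, congr_sectionHom hf A B ⟨x, hx'⟩ hy⟩

theorem map_congr_range_conj {X Y : Type*} [Group X] [Group Y] (e : X ≃* Y) :
    (MulAut.conj : X →* MulAut X).range.map (MulAut.congr e).toMonoidHom =
      (MulAut.conj : Y →* MulAut Y).range := by
  have key : ∀ x : X, MulAut.congr e (MulAut.conj x) = MulAut.conj (e x) := by
    intro x
    ext y
    change e (x * e.symm y * x⁻¹) = e x * y * (e x)⁻¹
    simp
  ext α
  constructor
  · rintro ⟨_, ⟨x, rfl⟩, rfl⟩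
    exact ⟨e x, (key x).symm⟩
  · rintro ⟨y, rfl⟩
    exact ⟨_, ⟨e.symm y, rfl⟩, by
      change MulAut.congr e (MulAut.conj (e.symm y)) = _
      rw [key, MulEquiv.apply_symm_apply]⟩

/-- A composition factor of `G/M` is isomorphic to its preimage section in `G`, and a nilpotent `J`
lifts to a nilpotent `N`. The isomorphism carries `⟨Aut_N, S⟩` upstairs to `⟨Aut_J, S⟩` downstairs.
-/
theorem SatisfiesStar.quotient [Finite G] (hG : SatisfiesStar G) (M : Subgroup G) [M.Normal] :
    SatisfiesStar (G ⧸ M) := by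
  intro A B hn hAB hcomm J hJ
  have hsurj := QuotientGroup.mk'_surjective M
  have hn' := normal_subgroupOf_comap (QuotientGroup.mk' M) hn
  obtain ⟨N, hN, rfl⟩ := exists_isNilpotent_map_mk_eq hJ
  let e := sectionEquiv hsurj A B
  have h := hG _ _ hAB.comap_mk (fun hc ↦ hcomm fun s t ↦ by
    have h1 := congrArg e (hc (e.symm s) (e.symm t))
    simpa using h1) N hN
  have h2 := h.of_equiv ((MulAut.congr e).subgroupMap _)
  have h3 : ∀ D : Subgroup (MulAut _), D.map (MulAut.congr e : MulAut _ →* MulAut _) =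
    D.map (MulAut.congr e).toMonoidHom := fun _ ↦ rfl
  rw [h3, Subgroup.map_sup, map_congr_inducedAut, map_congr_range_conj] at h2
  exact h2

end Quotient

/-! ### The induction on the order of `G` -/

theorem normalizer_sup_eq_of_satisfiesStar (G : Type u) [Group G] [Finite G]
    (hG : SatisfiesStar G) (H : Subgroup G) (hH : H.Normal) (K : Subgroup G) (hK : IsCarter K) :
    Subgroup.normalizer ((K ⊔ H : Subgroup G) : Set G) = K ⊔ H := by
  induction hn : Nat.card G using Nat.strong_induction_on generalizing G with
  | _ n ih =>
  subst hn
  by_cases hHb : H = ⊥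
  · rw [hHb, sup_bot_eq, hK.2]
  obtain ⟨M, hMH, hMn, hM, hmin⟩ := exists_isMinimalNormal_le hH hHb
  have hKM : Subgroup.normalizer ((K ⊔ M : Subgroup G) : Set G) = K ⊔ M := by
    by_cases hcomm : ∀ a ∈ M, ∀ b ∈ M, a * b = b * a
    · have := hK.1
      have hM : Group.IsSolvable M :=
        Group.isSolvable_of_comm fun a b ↦ Subtype.ext (hcomm a a.2 b b.2)
      -- An extension of the abelian group `M` by a subgroup of the nilpotent image of `K`.
      have hsol : Group.IsSolvable ↥(K ⊔ M) := by
        have hKs : Group.IsNilpotent (K.map (QuotientGroup.mk' M)) := isNilpotent_map hK.1 _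
        have hle : (K ⊔ M).map (QuotientGroup.mk' M) ≤ K.map (QuotientGroup.mk' M) := by
          rw [Subgroup.map_sup, (Subgroup.map_eq_bot_iff M).mpr (QuotientGroup.ker_mk' M).ge,
            sup_bot_eq]
        refine Group.isSolvable_of_ker_le_range (Subgroup.inclusion (le_sup_right : M ≤ K ⊔ M))
          (((QuotientGroup.mk' M).comp (K ⊔ M).subtype).codRestrict (K.map (QuotientGroup.mk' M))
            fun x ↦ hle ⟨x, x.2, rfl⟩) fun x hx ↦ ?_
        have h1 : QuotientGroup.mk' M (x : G) = 1 := congrArg Subtype.val hx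
        exact ⟨⟨x, (QuotientGroup.eq_one_iff _).mp h1⟩, rfl⟩
      exact normalizer_sup_eq_of_carterConjugate hK (carterConjugate_of_isSolvable _)
    · obtain ⟨T, hT⟩ := exists_isMinimalNormalIn hM
      have h : IsNonabelianMinimal M T := ⟨hMn, hmin, hcomm, hT⟩
      refine normalizer_sup_eq hK fun x hx ↦ ?_
      -- Since `x` normalizes `KM` and `M`, the conjugate `K^x` also satisfies `K^x M = KM`.
      refine h.exists_conj_eq hG hK (hK.conj x) rfl ?_
      have h1 := mem_normalizer_iff_map_conj.mp hx
      rwa [Subgroup.map_sup, (mem_normalizer_iff_map_conj (K := M)).mp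
        (by rw [Subgroup.normalizer_eq_top]; trivial)] at h1
  have hlt : Nat.card (G ⧸ M) < Nat.card G := by
    rw [Subgroup.card_eq_card_quotient_mul_card_subgroup M]
    exact lt_mul_of_one_lt_right Nat.card_pos (Subgroup.one_lt_card_iff_ne_bot M |>.mpr hM)
  have hsurj := QuotientGroup.mk'_surjective M
  have h1 := ih _ hlt (G ⧸ M) (hG.quotient M) (H.map (QuotientGroup.mk' M)) (hH.map _ hsurj)
    (K.map (QuotientGroup.mk' M)) (isCarter_map_mk hK.1 hKM) rfl
  rw [← Subgroup.map_sup] at h1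
  -- Because `M ≤ H`, the preimage of `KH/M` is `KH`, so self-normalization lifts to `G`.
  have h2 := congrArg (Subgroup.comap (QuotientGroup.mk' M)) h1
  rwa [Subgroup.comap_normalizer_eq_of_surjective _ hsurj, Subgroup.comap_map_eq,
    QuotientGroup.ker_mk', sup_assoc, sup_of_le_left hMH] at h2

end CarterSubgroups

theorem lemma4 (G : Type*) [Group G] [Finite G] (hG : CarterSubgroups.SatisfiesStar G)
    (H : Subgroup G) [H.Normal] (K : Subgroup G) (hK : CarterSubgroups.IsCarter K) :
    CarterSubgroups.IsCarter (K.map (QuotientGroup.mk' H)) :=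
  CarterSubgroups.isCarter_map_mk hK.1
    (CarterSubgroups.normalizer_sup_eq_of_satisfiesStar G hG H inferInstance K hK)
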